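/- Let $\mathbb X$ be a Polish space with its Borel $\sigma$-algebra, let $\Phi$ be an almost surely finite simple point process on $\mathbb X$ (a random finite sum of unit masses at distinct points), and let $H$ be a probability measure on $\mathbb R_+=[0,\infty)$. For a finite simple point process $\Phi'=\sum_j\delta_{X_j}$ with law $\mathbf P'$, let $\mathrm{RM}(\mathbf P';H)$ denote the law of the random measure $\sum_j S_j\delta_{X_j}$, where the marks $S_j$ attached to the points of $\Phi'$ are i.i.d. with law $H$ and independent of $\Phi'$. Let $\tilde\mu\sim\mathrm{RM}(\mathbf P_\Phi;H)$ and $\tilde p=\tilde\mu/\tilde\mu(\mathbb X)$, with $\tilde p:=0$ if $\tilde\mu(\mathbb X)=0$, in which case no observation is generated. For $n\ge1$ let $\boldsymbol Y=(Y_1,\dots,Y_n)$ be, given $\tilde\mu$, an i.i.d. sample from $\tilde p$, i.e. $\mathsf P(\boldsymbol Y\in C)=\mathsf E[\tilde p^{\,n}(C)]$ for measurable $C\subseteq\mathbb X^n$, where $\tilde p^{\,n}$ is the $n$-fold product measure. Let $\tilde\pi$ be the random partition of $\{1,\dots,n\}$ given by $i\sim j\iff Y_i=Y_j$. Fix a partition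 $\pi$ of $\{1,\dots,n\}$ into $k$ blocks, labelled $1,\dots,k$ in any order, with sizes $n_1,\dots,n_k$. On $\{\tilde\pi=\pi\}$ let $\boldsymbol Y^*=(Y^*_1,\dots,Y_k^*)$, where $Y_j^*$ is the common value of the $Y_i$ with $i$ in the $j$-th block. Let $M_{\Phi^k}(B)=\mathsf E[\Phi^k(B)]$ be the $k$-th moment measure of $\Phi$ (where $\Phi^k$ is the $k$-fold product measure), so that $M_{\Phi^k}(A_1\times\dots\times A_k)=\mathsf E[\prod_j\Phi(A_j)]$. Let $\{\mathbf P_\Phi^{\boldsymbol x}\}_{\boldsymbol x\in\mathbb X^k}$ be any family of $k$-th Palm distributions of $\Phi$, i.e. a probability kernel from $\mathbb X^k$ to the space of measures on $\mathbb X$ with $\mathsf E[\mathbf 1_L(\Phi)\,\Phi^k(B)]=\int_B\mathbf P_\Phi^{\boldsymbol x}(L)\,M_{\Phi^k}(d\boldsymbol x)$ for all measurable $B$ and $L$. For $\boldsymbol x$ with distinct coordinates, let $\Phi^!_{\boldsymbol x}=\Phi_{\boldsymbol x}-\sum_{j=1}^k\delta_{x_j}$ with $\Phi_{\boldsymbol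 x}\sim\mathbf P_\Phi^{\boldsymbol x}$, and let $\tilde\mu^!_{\boldsymbol x}\sim\mathrm{RM}(\mathbf P_{\Phi^!}^{\boldsymbol x};H)$, where $\mathbf P_{\Phi^!}^{\boldsymbol x}$ is the law of $\Phi^!_{\boldsymbol x}$. Put $\kappa(u,m)=\int_{\mathbb R_+}e^{-us}s^m\,H(ds)$ and $$ f_\pi(\boldsymbol y^*)=\int_0^\infty\frac{u^{n-1}}{\Gamma(n)}\,\mathsf E\big[e^{-u\,\tilde\mu^!_{\boldsymbol y^*}(\mathbb X)}\big]\prod_{j=1}^k\kappa(u,n_j)\,du . $$ Then $\mathsf P(\boldsymbol Y^*\in d\boldsymbol y^*,\ \tilde\pi=\pi)=f_\pi(\boldsymbol y^*)\,M_{\Phi^k}(d\boldsymbol y^*)$ on the set $\mathbb X^k_{\ne}$ of vectors $\boldsymbol y^*\in\mathbb X^k$ with pairwise distinct coordinates. That is, for every measurable $B\subseteq\mathbb X^k$, $$ \mathsf P(\boldsymbol Y^*\in B,\ \tilde\pi=\pi)=\int_{B\cap\mathbb X^k_{\ne}} f_\pi(\boldsymbol y^*)\,M_{\Phi^k}(d\boldsymbol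 y^*), $$ and, equivalently for the sample itself, for every measurable $C\subseteq\mathbb X^n$, $$ \mathsf P(\boldsymbol Y\in C,\ \tilde\pi=\pi)=\int_{\mathbb X^k_{\ne}}\mathbf 1\{(y^*_{c(1)},\dots,y^*_{c(n)})\in C\}\, f_\pi(\boldsymbol y^*)\,M_{\Phi^k}(d\boldsymbol y^*), $$ where $c(i)$ is the label of the block of $\pi$ that contains $i$. -/

import Mathlib

open MeasureTheory ProbabilityTheory Set
open scoped ENNReal NNReal

noncomputable section

namespace NormalizedRM

variable {X : Type*} [MeasurableSpace X]

/-- `ν` is a finite simple counting measure: a sum of unit masses at finitely many distinct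
points. A finite simple point process is a random measure that almost surely has this form. -/
def IsFiniteSimple (ν : Measure X) : Prop :=
  ∃ F : Finset X, ν = ∑ x ∈ F, Measure.dirac x

/-- The realization `∑ δ_(x, s x)` of a marked point process, where `x` runs over the points of the
simple counting measure `ν` and `s x` is the mark of the point `x`. -/
def attachMarks (ν : Measure X) (s : X → ℝ≥0) : Measure (X × ℝ≥0) :=
  Measure.sum fun x : {x : X // ν {x} ≠ 0} => Measure.dirac ((x : X), s x)

/-- The law of the marked point configuration obtained from the (deterministic) configuration `ν`
by giving its points i.i.d. marks with distribution `H`. -/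
def markLaw (H : Measure ℝ≥0) [IsProbabilityMeasure H] (ν : Measure X) :
    Measure (Measure (X × ℝ≥0)) :=
  (Measure.infinitePi fun _ : X => H).map (attachMarks ν)

/-- The law of the marked point process `Ψ` obtained from a point process `Φ` with law `Q` by
giving its points i.i.d. marks with distribution `H`. -/
def markedLaw (Q : Measure (Measure X)) (H : Measure ℝ≥0) [IsProbabilityMeasure H] :
    Measure (Measure (X × ℝ≥0)) :=
  Q.bind (markLaw H)

/-- The measure `B ↦ ∫_{B × ℝ₊} s ψ(dx ds)` on `X`. -/
def weigh (ψ : Measure (X × ℝ≥0)) : Measure X :=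
  (ψ.withDensity fun z => (z.2 : ℝ≥0∞)).map Prod.fst

/-- `RM(Q; H)`: the law of the random measure `μ̃(B) = ∫_{B × ℝ₊} s Ψ(dx ds)`, where `Ψ` is the
point process with law `Q`, marked with i.i.d. marks from `H`. -/
def RM (Q : Measure (Measure X)) (H : Measure ℝ≥0) [IsProbabilityMeasure H] :
    Measure (Measure X) :=
  (markedLaw Q H).map weigh

/-- The normalization `μ / μ(X)`. It is the zero measure when `μ(X) = 0`. -/
def normalize (μ : Measure X) : Measure X := (μ univ)⁻¹ • μ

/-- The marginal law of a sample `(Y₁, …, Yₙ)` which is i.i.d. from `p̃ = μ̃ / μ̃(X)` given `μ̃`,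
where `μ̃` has law `RM(Q; H)`: the mixture of the product measures `p̃ⁿ`. For `n ≥ 1` there
is no contribution from the event `μ̃(X) = 0`, on which no observation is generated. -/
def sampleLaw (Q : Measure (Measure X)) (H : Measure ℝ≥0) [IsProbabilityMeasure H] (n : ℕ) :
    Measure (Fin n → X) :=
  (RM Q H).bind fun μ => Measure.pi fun _ : Fin n => normalize μ

/-- The `k`-th moment measure `M_{Φ^k}(B) = E[Φ^k(B)]` of a point process `Φ` with law `Q`, so that
`M_{Φ^k}(A₁ × ⋯ × A_k) = E[Φ(A₁) ⋯ Φ(A_k)]`. -/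
def momentMeasure (Q : Measure (Measure X)) (k : ℕ) : Measure (Fin k → X) :=
  Q.bind fun ν => Measure.pi fun _ : Fin k => ν

/-- The probability kernel `P` is a family of `k`-th Palm distributions of a point process `Φ`
with law `Q`: it disintegrates the `k`-th Campbell measure `C(B × L) = E[1_L(Φ) Φ^k(B)]` with
respect to the `k`-th moment measure. -/
structure IsPalmKernel (Q : Measure (Measure X)) {k : ℕ}
    (P : Kernel (Fin k → X) (Measure X)) : Prop where
  isMarkov : IsMarkovKernel P
  disintegrates : ∀ (B : Set (Fin k → X)) (L : Set (Measure X)), MeasurableSet B →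
    MeasurableSet L →
    ∫⁻ ν in L, (Measure.pi fun _ : Fin k => ν) B ∂Q = ∫⁻ x in B, P x L ∂(momentMeasure Q k)

/-- The reduced Palm distribution at `x = (x₁, …, x_k)`: the law of `Φ_x - ∑ⱼ δ_{xⱼ}`, where `Φ_x`
has law `P x`. -/
def reducedPalm {k : ℕ} (P : Kernel (Fin k → X) (Measure X)) (x : Fin k → X) :
    Measure (Measure X) :=
  (P x).map fun ν => ν - ∑ j, Measure.dirac (x j)

/-- `κ(u, m) = ∫ e^{-us} s^m H(ds)`. -/
def kappa (H : Measure ℝ≥0) (u : ℝ) (m : ℕ) : ℝ≥0∞ :=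
  ∫⁻ s, ENNReal.ofReal (Real.exp (-u * s) * (s : ℝ) ^ m) ∂H

/-- `E[exp(-u μ(X))]` for a random measure `μ` with law `Λ`. -/
def laplaceMass (Λ : Measure (Measure X)) (u : ℝ) : ℝ≥0∞ :=
  ∫⁻ μ : Measure X, ENNReal.ofReal (Real.exp (-u * (μ univ).toReal)) ∂Λ

/-- The size of the `j`-th block of the partition of `[n]` whose blocks are labelled by `c`. -/
def count {n k : ℕ} (c : Fin n → Fin k) (j : Fin k) : ℕ :=
  (Finset.univ.filter fun i => c i = j).card

/-- The vector of the values of the sample `y` on the blocks of the partition labelled by `c`. It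
is used for samples `y` which are constant on the blocks. -/
def blockValues {n k : ℕ} {c : Fin n → Fin k} (hc : Function.Surjective c) (y : Fin n → X) :
    Fin k → X :=
  fun j => y (Function.surjInv hc j)

/-- `∫_0^∞ u^{n-1}/Γ(n) E[exp(-u μ̃^!_{y*}(X))] ∏ⱼ κ(u, nⱼ) du`, where `nⱼ` are the block sizes of `c`
and `μ̃^!_{y*}` has law `RM(Q; H)` with `Q` the reduced Palm distribution at `y*`. -/
def marginalDensity {n k : ℕ} (H : Measure ℝ≥0) [IsProbabilityMeasure H]
    (P : Kernel (Fin k → X) (Measure X)) (c : Fin n → Fin k) (ystar : Fin k → X) : ℝ≥0∞ :=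
  ∫⁻ u in Ioi (0 : ℝ), ENNReal.ofReal (u ^ (n - 1) / Real.Gamma n) *
    laplaceMass (RM (reducedPalm P ystar) H) u * ∏ j, kappa H u (count c j)

end NormalizedRM

end

/-! The obstacle is the random denominator `S = μ̃(X)`. The identity `S⁻ⁿ = ∫ u^{n-1}/Γ(n) e^{-uS}
du` (`lintegral_gamma`) turns it into an exponential, which factorises over independent marks.

Consider a fixed configuration of `m` points. Samples inducing the given partition correspond to
injective assignments `e` of points to blocks, and such a sample has conditional probability `∏ⱼ
(s(eⱼ)/S)^{nⱼ}`. By Tonelli and independence its mean is the `u`-integral of `κ(u,0)^{m-k} ∏ⱼ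
κ(u,nⱼ)` against `u^{n-1}/Γ(n)` (`lintegral_exp_mul_prod`, `lintegral_prod_normalized`). This weight
depends only on `m`, so summing over `e` gives the weight times the `Φ^k`-mass of the admissible
vectors (`lintegral_pi_normalize`, `sampleLaw_apply`).

Averaging over `Φ` is the Campbell formula (`IsPalmKernel.lintegral_mul_pi`), which moves the weight
under the Palm distribution. There the points `x₁, …, x_k` almost surely belong to the configuration
(`IsPalmKernel.ae_exists_finset`). Removing them leaves `m - k` points, and the mean of
`κ(u,0)^{m-k}` is the Laplace transform in `f_π` (`marginalDensity_eq`).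

The remaining work is measurability in the configuration, obtained from versions that agree almost
surely. -/

noncomputable section

namespace NormalizedRM

/-! ### Finitely supported measures, label vectors, the gamma integral and independence -/

section

section Deterministic

variable {X : Type*} [MeasurableSpace X]

/-- The product of finitely supported measures is finitely supported. -/
theorem pi_sum_smul_dirac (F : Finset X) (w : X → ℝ≥0∞) (hw : ∀ x ∈ F, w x ≠ ∞) (m : ℕ) :
    Measure.pi (fun _ : Fin m => ∑ x ∈ F, w x • Measure.dirac x) =
      ∑ y ∈ Fintype.piFinset (fun _ : Fin m => F), (∏ i, w (y i)) • Measure.dirac y := by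
  classical
  have : IsFiniteMeasure (∑ x ∈ F, w x • Measure.dirac x) := by
    refine ⟨?_⟩
    simp only [Measure.coe_finsetSum, Finset.sum_apply, Measure.smul_apply, smul_eq_mul,
      measure_univ, mul_one]
    exact ENNReal.sum_lt_top.2 fun x hx => (hw x hx).lt_top
  refine Measure.pi_eq fun s hs => ?_
  simp only [Measure.coe_finsetSum, Finset.sum_apply, Measure.smul_apply, smul_eq_mul]
  rw [Finset.prod_univ_sum]
  refine Finset.sum_congr rfl fun y _ => ?_
  rw [Finset.prod_mul_distrib, Measure.dirac_apply' _ (MeasurableSet.univ_pi hs)]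
  congr 1
  simp only [Measure.dirac_apply' _ (hs _), Set.indicator_apply, Pi.one_apply, Set.mem_univ_pi,
    Finset.prod_ite_zero, Finset.mem_univ, true_imp_iff, Finset.prod_const_one]

theorem pi_sum_dirac (F : Finset X) (m : ℕ) :
    Measure.pi (fun _ : Fin m => ∑ x ∈ F, Measure.dirac x) =
      ∑ y ∈ Fintype.piFinset (fun _ : Fin m => F), Measure.dirac y := by
  simpa using pi_sum_smul_dirac F (fun _ => 1) (by simp) m

theorem prod_comp_eq_prod_pow_count {n k : ℕ} (c : Fin n → Fin k) (f : Fin k → ℝ≥0∞) :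
    ∏ i, f (c i) = ∏ j, f j ^ count c j := by
  classical
  rw [← Finset.prod_fiberwise (s := Finset.univ) (g := c)]
  refine Finset.prod_congr rfl fun j _ => ?_
  rw [Finset.prod_congr rfl (g := fun _ => f j), Finset.prod_const]
  · rfl
  · intro i hi
    rw [(Finset.mem_filter.1 hi).2]

theorem ker_comp_eq_iff {X : Type*} {n k : ℕ} {c : Fin n → Fin k} (hc : Function.Surjective c)
    (e : Fin k → X) : Setoid.ker (e ∘ c) = Setoid.ker c ↔ Function.Injective e := by
  constructor
  · intro h a b hab
    obtain ⟨i, rfl⟩ := hc a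
    obtain ⟨j, rfl⟩ := hc b
    have : Setoid.ker (e ∘ c) i j := hab
    rw [h] at this
    exact this
  · intro he
    ext i j
    exact he.eq_iff

theorem blockValues_comp {X : Type*} {n k : ℕ} {c : Fin n → Fin k} (hc : Function.Surjective c)
    (e : Fin k → X) : blockValues hc (e ∘ c) = e := by
  funext j
  exact congrArg e (Function.surjInv_eq hc j)

theorem comp_blockValues {X : Type*} {n k : ℕ} {c : Fin n → Fin k} (hc : Function.Surjective c)
    {y : Fin n → X} (hy : Setoid.ker y = Setoid.ker c) : blockValues hc y ∘ c = y := by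
  funext i
  have : Setoid.ker c (Function.surjInv hc (c i)) i := Function.surjInv_eq hc (c i)
  rw [← hy] at this
  exact this

/-- Samples which induce the partition labelled by `c` correspond to vectors of distinct values. -/
theorem sum_ker_eq {X : Type*} {n k : ℕ} {c : Fin n → Fin k} (hc : Function.Surjective c)
    (F : Finset X) (C : Set (Fin n → X)) (g : (Fin n → X) → ℝ≥0∞) :
    ∑ y ∈ Fintype.piFinset (fun _ : Fin n => F),
        (C ∩ {y | Setoid.ker y = Setoid.ker c}).indicator g y =
      ∑ e ∈ Fintype.piFinset (fun _ : Fin k => F),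
        {e : Fin k → X | Function.Injective e ∧ e ∘ c ∈ C}.indicator (fun e => g (e ∘ c)) e := by
  classical
  simp only [Set.indicator_apply]
  rw [← Finset.sum_filter, ← Finset.sum_filter]
  refine Finset.sum_nbij' (fun y => blockValues hc y) (fun e => e ∘ c) ?_ ?_ ?_ ?_ ?_
  · intro y hy
    simp only [Finset.mem_filter, Fintype.mem_piFinset, Set.mem_inter_iff, Set.mem_ofPred_eq]
      at hy ⊢
    refine ⟨fun j => hy.1 _, ?_⟩
    rw [← ker_comp_eq_iff hc, comp_blockValues hc hy.2.2]
    exact ⟨hy.2.2, hy.2.1⟩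
  · intro e he
    simp only [Finset.mem_filter, Fintype.mem_piFinset, Set.mem_inter_iff, Set.mem_ofPred_eq]
      at he ⊢
    exact ⟨fun i => he.1 _, he.2.2, (ker_comp_eq_iff hc e).2 he.2.1⟩
  · intro y hy
    exact comp_blockValues hc (Finset.mem_filter.1 hy).2.2
  · intro e _
    exact blockValues_comp hc e
  · intro y hy
    rw [comp_blockValues hc (Finset.mem_filter.1 hy).2.2]

theorem measurableSet_ker_eq [MeasurableEq X] {n k : ℕ} (c : Fin n → Fin k) :
    MeasurableSet {y : Fin n → X | Setoid.ker y = Setoid.ker c} := by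
  have : {y : Fin n → X | Setoid.ker y = Setoid.ker c} =
      ⋂ i, ⋂ j, {y : Fin n → X | y i = y j ↔ c i = c j} := by
    ext y
    simp only [Set.mem_ofPred_eq, Set.mem_iInter, Setoid.ext_iff]
    rfl
  rw [this]
  refine MeasurableSet.iInter fun i => MeasurableSet.iInter fun j => ?_
  have h := measurableSet_eq_fun (measurable_pi_apply (X := fun _ : Fin n => X) i)
    (measurable_pi_apply j)
  by_cases hij : c i = c j
  · simpa only [hij, iff_true] using h
  · simp only [hij, iff_false]
    exact h.compl

theorem measurableSet_injective [MeasurableEq X] (k : ℕ) :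
    MeasurableSet {e : Fin k → X | Function.Injective e} := by
  have : {e : Fin k → X | Function.Injective e} =
      {e | Setoid.ker e = Setoid.ker (id : Fin k → Fin k)} := by
    ext e
    exact (ker_comp_eq_iff Function.surjective_id e).symm
  rw [this]
  exact measurableSet_ker_eq id

theorem lintegral_gamma {n : ℕ} (hn : 1 ≤ n) {S : ℝ≥0} (hS : S ≠ 0) :
    ∫⁻ u in Ioi (0 : ℝ), ENNReal.ofReal (u ^ (n - 1) / Real.Gamma n) *
      ENNReal.ofReal (Real.exp (-u * S)) = ((S : ℝ≥0∞)⁻¹) ^ n := by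
  have hn0 : (0 : ℝ) < n := by exact_mod_cast hn
  have hS0 : (0 : ℝ) < S := by positivity
  have hG := Real.Gamma_pos_of_pos hn0
  have key := Real.integral_rpow_mul_exp_neg_mul_Ioi hn0 hS0
  have heq : ∀ u ∈ Ioi (0 : ℝ), ENNReal.ofReal (u ^ (n - 1) / Real.Gamma n) *
      ENNReal.ofReal (Real.exp (-u * S)) =
      ENNReal.ofReal ((Real.Gamma n)⁻¹ * (u ^ ((n : ℝ) - 1) * Real.exp (-(S * u)))) := by
    intro u hu
    have hu0 : (0 : ℝ) < u := hu
    have hpow : u ^ ((n : ℝ) - 1) = u ^ (n - 1) := by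
      rw [← Real.rpow_natCast, Nat.cast_sub hn, Nat.cast_one]
    rw [← ENNReal.ofReal_mul (by positivity), hpow]
    congr 1
    rw [show -u * (S : ℝ) = -(S * u) by ring]
    ring
  rw [setLIntegral_congr_fun measurableSet_Ioi heq, ← ofReal_integral_eq_lintegral_ofReal,
    integral_const_mul, key]
  · rw [one_div, Real.rpow_natCast]
    rw [mul_comm, mul_assoc, mul_inv_cancel₀ hG.ne', mul_one,
      ENNReal.ofReal_pow (by positivity), ENNReal.ofReal_inv_of_pos hS0, ENNReal.ofReal_coe_nnreal]
  · refine Integrable.const_mul ?_ _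
    -- A non-integrable integrand would have Bochner integral 0, against the positive value in
    -- `key`.
    by_contra h
    rw [integral_undef h] at key
    have : 0 < (1 / (S : ℝ)) ^ (n : ℝ) * Real.Gamma n := by positivity
    exact this.ne key
  · filter_upwards [ae_restrict_mem measurableSet_Ioi] with u hu
    have hu0 : (0 : ℝ) < u := hu
    have := hG.le
    positivity

theorem lintegral_infinitePi_prod {X : Type*} (H : Measure ℝ≥0) [IsProbabilityMeasure H] (F : Finset X)
    (f : X → ℝ≥0 → ℝ≥0∞) (hf : ∀ x, Measurable (f x)) :
    ∫⁻ s, ∏ x ∈ F, f x (s x) ∂(Measure.infinitePi fun _ : X => H) = ∏ x ∈ F, ∫⁻ t, f x t ∂H := by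
  have hind : iIndepFun (fun x (s : X → ℝ≥0) => f x (s x)) (Measure.infinitePi fun _ : X => H) :=
    iIndepFun_infinitePi (P := fun _ : X => H) (X := f) hf
  rw [lintegral_prod_eq_prod_lintegral_of_indepFun F _ hind
    fun x => (hf x).comp (measurable_pi_apply x)]
  refine Finset.prod_congr rfl fun x _ => ?_
  rw [← (measurePreserving_eval_infinitePi (fun _ : X => H) x).lintegral_comp (hf x)]

end Deterministic

end

/-! ### Sampling from a fixed configuration with i.i.d. marks -/

section

theorem measurable_kappa_integrand (m : ℕ) : Measurable fun p : ℝ × ℝ≥0 =>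
    ENNReal.ofReal (Real.exp (-p.1 * p.2) * (p.2 : ℝ) ^ m) := by
  fun_prop

theorem measurable_kappa (H : Measure ℝ≥0) [SFinite H] (m : ℕ) :
    Measurable fun u => kappa H u m :=
  (measurable_kappa_integrand m).lintegral_prod_right'

theorem prod_eq_prod_pow_card {X : Type*} [DecidableEq X] (F : Finset X) {n : ℕ}
    (y : Fin n → X) (hy : ∀ i, y i ∈ F) (f : X → ℝ≥0∞) :
    ∏ i, f (y i) = ∏ x ∈ F, f x ^ (Finset.univ.filter fun i => y i = x).card := by
  rw [← Finset.prod_fiberwise_of_maps_to (s := Finset.univ) (t := F) (g := y) fun i _ => hy i]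
  refine Finset.prod_congr rfl fun x _ => ?_
  rw [Finset.prod_congr rfl (g := fun _ => f x), Finset.prod_const]
  intro i hi
  rw [(Finset.mem_filter.1 hi).2]

/-- The expectation of `e^{-uS} ∏ s(eⱼ)^{nⱼ}`, where `S` is the sum of i.i.d. marks `s`. -/
theorem lintegral_exp_mul_prod {X : Type*} (H : Measure ℝ≥0) [IsProbabilityMeasure H]
    (F : Finset X) {n k : ℕ} {c : Fin n → Fin k} {e : Fin k → X}
    (he : Function.Injective e) (heF : ∀ j, e j ∈ F) (u : ℝ) :
    ∫⁻ s, ENNReal.ofReal (Real.exp (-u * ((∑ x ∈ F, s x : ℝ≥0) : ℝ))) *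
        ∏ j, (s (e j) : ℝ≥0∞) ^ count c j ∂(Measure.infinitePi fun _ : X => H) =
      kappa H u 0 ^ (F.card - k) * ∏ j, kappa H u (count c j) := by
  classical
  -- The exponent of the mark at `x`: it is `nⱼ` at `eⱼ` and 0 at the points not selected, which
  -- therefore contribute `κ(u,0)` each.
  set m : X → ℕ := fun x => (Finset.univ.filter fun i => e (c i) = x).card with hm
  have h1 : ∀ s : X → ℝ≥0, ENNReal.ofReal (Real.exp (-u * ((∑ x ∈ F, s x : ℝ≥0) : ℝ))) *
      ∏ j, (s (e j) : ℝ≥0∞) ^ count c j =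
      ∏ x ∈ F, ENNReal.ofReal (Real.exp (-u * s x) * (s x : ℝ) ^ m x) := by
    intro s
    rw [← prod_comp_eq_prod_pow_count c fun j => (s (e j) : ℝ≥0∞),
      prod_eq_prod_pow_card F (fun i => e (c i)) (fun i => heF _) fun x => (s x : ℝ≥0∞),
      NNReal.coe_sum, Finset.mul_sum, Real.exp_sum,
      ENNReal.ofReal_prod_of_nonneg fun x _ => (Real.exp_pos _).le, ← Finset.prod_mul_distrib]
    refine Finset.prod_congr rfl fun x _ => ?_
    rw [ENNReal.ofReal_mul (Real.exp_pos _).le, ENNReal.ofReal_pow (NNReal.coe_nonneg _),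
      ENNReal.ofReal_coe_nnreal]
  simp_rw [h1]
  rw [lintegral_infinitePi_prod H F
    (fun x t => ENNReal.ofReal (Real.exp (-u * t) * (t : ℝ) ^ m x)) fun x => by fun_prop]
  change ∏ x ∈ F, kappa H u (m x) = _
  have hsub : Finset.univ.image e ⊆ F := by
    intro x hx
    obtain ⟨j, _, rfl⟩ := Finset.mem_image.1 hx
    exact heF j
  rw [← Finset.prod_sdiff hsub]
  congr 1
  · rw [Finset.prod_congr rfl (g := fun _ => kappa H u 0), Finset.prod_const,
      Finset.card_sdiff_of_subset hsub, Finset.card_image_of_injective _ he, Finset.card_univ,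
      Fintype.card_fin]
    intro x hx
    have : m x = 0 := by
      rw [hm, Finset.card_eq_zero, Finset.filter_eq_empty_iff]
      intro i _ hi
      exact (Finset.mem_sdiff.1 hx).2 (Finset.mem_image.2 ⟨c i, Finset.mem_univ _, hi⟩)
    rw [this]
  · rw [Finset.prod_image fun a _ b _ h => he h]
    refine Finset.prod_congr rfl fun j _ => ?_
    simp only [hm, he.eq_iff]
    rfl

/-- The Laplace transform of the sum of i.i.d. marks. -/
theorem lintegral_exp_sum {X : Type*} (H : Measure ℝ≥0) [IsProbabilityMeasure H]
    (F : Finset X) (u : ℝ) :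
    ∫⁻ s, ENNReal.ofReal (Real.exp (-u * ((∑ x ∈ F, s x : ℝ≥0) : ℝ)))
      ∂(Measure.infinitePi fun _ : X => H) = kappa H u 0 ^ F.card := by
  simpa using lintegral_exp_mul_prod (n := 0) (c := Fin.elim0) (e := Fin.elim0) H F
    (fun a => a.elim0) (fun a => a.elim0) u

/-- The weight of a vector of distinct values among the points of a configuration of `m` points. -/
def configurationWeight {n k : ℕ} (H : Measure ℝ≥0) (c : Fin n → Fin k) (m : ℕ) : ℝ≥0∞ :=
  ∫⁻ u in Ioi (0 : ℝ), ENNReal.ofReal (u ^ (n - 1) / Real.Gamma n) *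
    kappa H u 0 ^ (m - k) * ∏ j, kappa H u (count c j)

/-- The gamma integral applied to the total mark. If that total is 0, all selected marks vanish and
both sides are 0: `∞ * 0 = 0` on the left, and `n ≥ 1` makes the products nonempty. -/
theorem prod_normalized_eq_lintegral {X : Type*} {F : Finset X} {n k : ℕ} (hn : 1 ≤ n)
    {c : Fin n → Fin k} {e : Fin k → X} (heF : ∀ j, e j ∈ F) (s : X → ℝ≥0) :
    ∏ i, (((∑ x ∈ F, s x : ℝ≥0) : ℝ≥0∞)⁻¹ * s (e (c i))) =
      ∫⁻ u in Ioi (0 : ℝ), ENNReal.ofReal (u ^ (n - 1) / Real.Gamma n) *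
        (ENNReal.ofReal (Real.exp (-u * ((∑ x ∈ F, s x : ℝ≥0) : ℝ))) *
          ∏ j, (s (e j) : ℝ≥0∞) ^ count c j) := by
  rw [← prod_comp_eq_prod_pow_count c fun j => (s (e j) : ℝ≥0∞)]
  by_cases hS : ∑ x ∈ F, s x = 0
  · have h0 : ∀ j, s (e j) = 0 := fun j => Finset.sum_eq_zero_iff.1 hS _ (heF j)
    have hn' : n ≠ 0 := by omega
    simp [h0, hn']
  · simp_rw [← mul_assoc]
    rw [lintegral_mul_const' _ _ (ENNReal.prod_ne_top fun i _ => ENNReal.coe_ne_top),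
      lintegral_gamma hn hS, Finset.prod_mul_distrib, Finset.prod_const, Finset.card_univ,
      Fintype.card_fin]

theorem lintegral_prod_normalized {X : Type*} (H : Measure ℝ≥0) [IsProbabilityMeasure H]
    {F : Finset X} {n k : ℕ} (hn : 1 ≤ n) {c : Fin n → Fin k} {e : Fin k → X}
    (he : Function.Injective e) (heF : ∀ j, e j ∈ F) :
    ∫⁻ s, ∏ i, (((∑ x ∈ F, s x : ℝ≥0) : ℝ≥0∞)⁻¹ * s (e (c i)))
      ∂(Measure.infinitePi fun _ : X => H) = configurationWeight H c F.card := by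
  simp_rw [prod_normalized_eq_lintegral hn heF]
  rw [lintegral_lintegral_swap]
  · unfold configurationWeight
    refine lintegral_congr fun u => ?_
    rw [lintegral_const_mul', lintegral_exp_mul_prod H F he heF, mul_assoc]
    exact ENNReal.ofReal_ne_top
  · refine Measurable.aemeasurable ?_
    unfold Function.uncurry
    fun_prop

variable {X : Type*} [MeasurableSpace X]

theorem normalize_sum_smul_dirac (F : Finset X) (s : X → ℝ≥0) :
    normalize (∑ x ∈ F, (s x : ℝ≥0∞) • Measure.dirac x) =
      ∑ x ∈ F, (((∑ x ∈ F, s x : ℝ≥0) : ℝ≥0∞)⁻¹ * s x) • Measure.dirac x := by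
  have : (∑ x ∈ F, (s x : ℝ≥0∞) • Measure.dirac x) univ = ((∑ x ∈ F, s x : ℝ≥0) : ℝ≥0∞) := by
    simp [Measure.coe_finsetSum, Finset.sum_apply]
  rw [normalize, this, Finset.smul_sum]
  simp_rw [smul_smul]

/-- The probability that a sample from a normalized randomly weighted finite configuration lies
in `C` and induces the partition labelled by `c`. -/
theorem lintegral_pi_normalize [MeasurableEq X] (H : Measure ℝ≥0) [IsProbabilityMeasure H]
    (F : Finset X) {n k : ℕ} (hn : 1 ≤ n) {c : Fin n → Fin k} (hc : Function.Surjective c)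
    {C : Set (Fin n → X)} (hC : MeasurableSet C) :
    ∫⁻ s, Measure.pi (fun _ : Fin n => normalize (∑ x ∈ F, ((s x : ℝ≥0) : ℝ≥0∞) •
        Measure.dirac x)) (C ∩ {y | Setoid.ker y = Setoid.ker c})
        ∂(Measure.infinitePi fun _ : X => H) =
      configurationWeight H c F.card * Measure.pi (fun _ : Fin k => ∑ x ∈ F, Measure.dirac x)
        {e | Function.Injective e ∧ e ∘ c ∈ C} := by
  classical
  have hA : MeasurableSet (C ∩ {y : Fin n → X | Setoid.ker y = Setoid.ker c}) :=
    hC.inter (measurableSet_ker_eq c)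
  have hD : MeasurableSet {e : Fin k → X | Function.Injective e ∧ e ∘ c ∈ C} :=
    (measurableSet_injective k).inter
      ((measurable_pi_lambda _ fun i => measurable_pi_apply (c i)) hC)
  have h1 : ∀ s : X → ℝ≥0, Measure.pi (fun _ : Fin n => normalize (∑ x ∈ F,
      ((s x : ℝ≥0) : ℝ≥0∞) • Measure.dirac x)) (C ∩ {y | Setoid.ker y = Setoid.ker c}) =
      ∑ e ∈ Fintype.piFinset (fun _ : Fin k => F),
        {e : Fin k → X | Function.Injective e ∧ e ∘ c ∈ C}.indicator
          (fun e => ∏ i, (((∑ x ∈ F, s x : ℝ≥0) : ℝ≥0∞)⁻¹ * s (e (c i)))) e := by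
    intro s
    rw [normalize_sum_smul_dirac, pi_sum_smul_dirac]
    · simp only [Measure.coe_finsetSum, Finset.sum_apply, Measure.smul_apply, smul_eq_mul,
        Measure.dirac_apply' _ hA]
      refine Eq.trans ?_
        (sum_ker_eq hc F C fun y => ∏ i, (((∑ x ∈ F, s x : ℝ≥0) : ℝ≥0∞)⁻¹ * s (y i)))
      refine Finset.sum_congr rfl fun y _ => ?_
      simp [Set.indicator_apply]
    · intro x hx
      -- The weights are finite even for total mark 0, where the infinite inverse multiplies a zero
      -- mark.
      by_cases hS : ∑ x ∈ F, s x = 0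
      · simp [Finset.sum_eq_zero_iff.1 hS x hx]
      · exact ENNReal.mul_ne_top (ENNReal.inv_ne_top.2 (by exact_mod_cast hS)) ENNReal.coe_ne_top
  simp_rw [h1]
  rw [lintegral_finsetSum']
  · rw [pi_sum_dirac]
    simp only [Measure.coe_finsetSum, Finset.sum_apply, Measure.dirac_apply' _ hD]
    rw [Finset.mul_sum]
    refine Finset.sum_congr rfl fun e he => ?_
    by_cases h : e ∈ {e : Fin k → X | Function.Injective e ∧ e ∘ c ∈ C}
    · simp only [Set.indicator_of_mem h, Pi.one_apply, mul_one]
      exact lintegral_prod_normalized H hn h.1 (Fintype.mem_piFinset.1 he)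
    · simp only [Set.indicator_of_notMem h, lintegral_zero, mul_zero]
  · intro e _
    refine Measurable.aemeasurable ?_
    by_cases h : e ∈ {e : Fin k → X | Function.Injective e ∧ e ∘ c ∈ C}
    · simp only [Set.indicator_of_mem h]
      fun_prop
    · simp only [Set.indicator_of_notMem h]
      fun_prop

end

/-! ### Measurability in the configuration, and integrals against `RM` -/

section

open Classical in
/-- The measure `ν` if it is finite, and zero otherwise. -/
def finitePart {X : Type*} [MeasurableSpace X] (ν : Measure X) : Measure X :=
  if ν univ = ∞ then 0 else ν

/-- The number of points of a finite counting measure. -/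
def pointCount {X : Type*} [MeasurableSpace X] (ν : Measure X) : ℕ := ⌊(ν univ).toReal⌋₊

variable {X : Type*} [MeasurableSpace X]

instance isFiniteMeasure_finitePart (ν : Measure X) : IsFiniteMeasure (finitePart ν) := by
  unfold finitePart
  split_ifs with h
  · infer_instance
  · exact ⟨lt_top_iff_ne_top.2 h⟩

theorem finitePart_eq_self (ν : Measure X) [IsFiniteMeasure ν] : finitePart ν = ν :=
  if_neg (measure_ne_top ν univ)

theorem measurable_finitePart : Measurable (finitePart : Measure X → Measure X) :=
  Measurable.ite (Measure.measurable_coe MeasurableSet.univ (measurableSet_singleton ∞))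
    measurable_const measurable_id

theorem measurable_pointCount : Measurable (pointCount : Measure X → ℕ) :=
  Nat.measurable_floor.comp (Measure.measurable_coe MeasurableSet.univ).ennreal_toReal

/-- The number of points takes countably many values, so versions built for each fixed number can be
glued. -/
theorem measurable_apply_pointCount {β : Type*} [MeasurableSpace β] {f : ℕ → Measure X → β}
    (hf : ∀ m, Measurable (f m)) : Measurable fun ν : Measure X => f (pointCount ν) ν := by
  have h : Measurable fun p : Measure X × ℕ => f p.2 p.1 :=
    measurable_from_prod_countable_left hf
  exact h.comp (measurable_id.prodMk measurable_pointCount)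

theorem isFiniteMeasure_sum_dirac (F : Finset X) :
    IsFiniteMeasure (∑ x ∈ F, Measure.dirac x) := by
  refine ⟨?_⟩
  simp [Measure.coe_finsetSum, Finset.sum_apply]

theorem pointCount_sum_dirac (F : Finset X) : pointCount (∑ x ∈ F, Measure.dirac x) = F.card := by
  simp [pointCount, Measure.coe_finsetSum, Finset.sum_apply]

attribute [irreducible] pointCount

theorem IsFiniteSimple.isFiniteMeasure {ν : Measure X} (hν : IsFiniteSimple ν) :
    IsFiniteMeasure ν := by
  obtain ⟨F, rfl⟩ := hν
  exact isFiniteMeasure_sum_dirac F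

theorem measurable_pi_of_isFiniteMeasure {α : Type*} [MeasurableSpace α] {f : α → Measure X}
    [∀ a, IsFiniteMeasure (f a)] (hf : Measurable f) (m : ℕ) :
    Measurable fun a => Measure.pi fun _ : Fin m => f a := by
  refine Measurable.measure_of_isPiSystem generateFrom_pi.symm
    isPiSystem_pi ?_ ?_
  · rintro _ ⟨s, hs, rfl⟩
    simp only [Measure.pi_pi]
    exact Finset.measurable_prod _ fun i _ =>
      (Measure.measurable_coe (hs i (Set.mem_univ i))).comp hf
  · simp only [Measure.pi_univ]
    exact Finset.measurable_prod _ fun i _ => (Measure.measurable_coe MeasurableSet.univ).comp hf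

/-- The π-system argument concerns finite measures, so the version uses `finitePart ν`, which is
almost surely `ν`. -/
theorem aemeasurable_pi {Q : Measure (Measure X)} (hQ : ∀ᵐ ν ∂Q, IsFiniteSimple ν) (m : ℕ) :
    AEMeasurable (fun ν : Measure X => Measure.pi fun _ : Fin m => ν) Q := by
  refine ⟨fun ν => Measure.pi fun _ : Fin m => finitePart ν,
    measurable_pi_of_isFiniteMeasure measurable_finitePart m, ?_⟩
  filter_upwards [hQ] with ν hν
  have := hν.isFiniteMeasure
  rw [finitePart_eq_self]

instance isFiniteMeasure_normalize (μ : Measure X) : IsFiniteMeasure (normalize μ) := by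
  refine ⟨?_⟩
  rw [normalize, Measure.smul_apply, smul_eq_mul]
  -- The bound includes total masses 0 and `∞`, where the product is 0.
  exact (ENNReal.inv_mul_le_one _).trans_lt ENNReal.one_lt_top

theorem measurable_normalize : Measurable (normalize : Measure X → Measure X) := by
  refine Measure.measurable_of_measurable_coe _ fun s hs => ?_
  simp only [normalize, Measure.smul_apply, smul_eq_mul]
  exact (Measure.measurable_coe MeasurableSet.univ).inv.mul (Measure.measurable_coe hs)

theorem measurable_weigh : Measurable (weigh : Measure (X × ℝ≥0) → Measure X) := by
  refine Measure.measurable_of_measurable_coe _ fun s hs => ?_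
  have : (fun ψ : Measure (X × ℝ≥0) => weigh ψ s) =
      fun ψ => ∫⁻ z, (Prod.fst ⁻¹' s).indicator (fun z : X × ℝ≥0 => (z.2 : ℝ≥0∞)) z ∂ψ := by
    funext ψ
    rw [weigh, Measure.map_apply measurable_fst hs, withDensity_apply _ (measurable_fst hs),
      lintegral_indicator (measurable_fst hs)]
  rw [this]
  exact Measure.measurable_lintegral
    (Measurable.indicator (by fun_prop) (measurable_fst hs))

theorem measurable_sum_dirac {α β ι : Type*} [MeasurableSpace α] [MeasurableSpace β]
    (F : Finset ι) {f : ι → α → β} (hf : ∀ i, Measurable (f i)) :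
    Measurable fun a => ∑ i ∈ F, Measure.dirac (f i a) := by
  refine Measure.measurable_of_measurable_coe _ fun s hs => ?_
  simp only [Measure.coe_finsetSum, Finset.sum_apply]
  exact Finset.measurable_sum _ fun i _ =>
    (Measure.measurable_coe hs).comp (Measure.measurable_dirac.comp (hf i))

theorem weigh_sum_dirac (F : Finset X) (s : X → ℝ≥0) :
    weigh (∑ x ∈ F, Measure.dirac (x, s x)) = ∑ x ∈ F, (s x : ℝ≥0∞) • Measure.dirac x := by
  ext B hB
  rw [weigh, Measure.map_apply measurable_fst hB, withDensity_apply _ (measurable_fst hB),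
    ← lintegral_indicator (measurable_fst hB), lintegral_finsetSum_measure,
    Measure.coe_finsetSum, Finset.sum_apply]
  refine Finset.sum_congr rfl fun x _ => ?_
  rw [Measure.smul_apply, smul_eq_mul,
    lintegral_dirac' _ (Measurable.indicator (by fun_prop) (measurable_fst hB)),
    Measure.dirac_apply' _ hB]
  by_cases hx : x ∈ B
  · rw [Set.indicator_of_mem hx, Set.indicator_of_mem (show (x, s x) ∈ Prod.fst ⁻¹' B from hx),
      Pi.one_apply, mul_one]
  · rw [Set.indicator_of_notMem hx,
      Set.indicator_of_notMem (show (x, s x) ∉ Prod.fst ⁻¹' B from hx), mul_zero]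

section Singleton

variable [MeasurableSingletonClass X]

theorem sum_dirac_singleton_ne_zero_iff (F : Finset X) (x : X) :
    (∑ y ∈ F, Measure.dirac y) {x} ≠ 0 ↔ x ∈ F := by
  simp only [Measure.coe_finsetSum, Finset.sum_apply, ne_eq, Finset.sum_eq_zero_iff,
    Measure.dirac_apply, Set.indicator_apply_eq_zero, Set.mem_singleton_iff, Pi.one_apply,
    one_ne_zero, imp_false, not_forall, not_not]
  constructor
  · rintro ⟨y, hy, rfl⟩
    exact hy
  · intro hx
    exact ⟨x, hx, rfl⟩

theorem attachMarks_sum_dirac (F : Finset X) (s : X → ℝ≥0) :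
    attachMarks (∑ x ∈ F, Measure.dirac x) s = ∑ x ∈ F, Measure.dirac (x, s x) := by
  ext B hB
  rw [← Measure.sum_coe_finset F fun x => Measure.dirac (x, s x), attachMarks,
    Measure.sum_apply _ hB, Measure.sum_apply _ hB]
  exact (Equiv.subtypeEquivRight fun x => sum_dirac_singleton_ne_zero_iff F x).tsum_eq
    fun x : {x // x ∈ F} => Measure.dirac ((x : X), s x) B

theorem measurable_attachMarks_of_isFiniteSimple {ν : Measure X} (hν : IsFiniteSimple ν) :
    Measurable (attachMarks ν) := by
  obtain ⟨F, rfl⟩ := hν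
  have : attachMarks (∑ x ∈ F, Measure.dirac x) = fun s => ∑ x ∈ F, Measure.dirac (x, s x) :=
    funext fun s => attachMarks_sum_dirac F s
  rw [this]
  exact measurable_sum_dirac F fun x => measurable_const.prodMk (measurable_pi_apply x)

end Singleton

/-- The law of the marked configuration with points `x₁, …, x_m` and i.i.d. marks. -/
def markVector {m : ℕ} (H : Measure ℝ≥0) (x : Fin m → X) : Measure (Measure (X × ℝ≥0)) :=
  (Measure.pi fun _ : Fin m => H).map fun s => ∑ i, Measure.dirac (x i, s i)

/-- Marks indexed by position form a finite vector, so the configuration is jointly measurable in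
points and marks, and the measure of its sections is measurable. -/
theorem measurable_markVector (H : Measure ℝ≥0) [IsProbabilityMeasure H] (m : ℕ) :
    Measurable (markVector H : (Fin m → X) → _) := by
  have hm : Measurable fun p : (Fin m → X) × (Fin m → ℝ≥0) =>
      ∑ i, Measure.dirac (p.1 i, p.2 i) :=
    measurable_sum_dirac _ fun i => by fun_prop
  refine Measure.measurable_of_measurable_coe _ fun L hL => ?_
  have : (fun x : Fin m → X => markVector H x L) = fun x =>
      (Measure.pi fun _ : Fin m => H) (Prod.mk x ⁻¹'
        ((fun p : (Fin m → X) × (Fin m → ℝ≥0) => ∑ i, Measure.dirac (p.1 i, p.2 i)) ⁻¹' L)) := by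
    funext x
    exact Measure.map_apply (hm.comp measurable_prodMk_left) hL
  rw [this]
  exact measurable_measure_prodMk_left (hm hL)

theorem markVector_eq_markLaw [MeasurableSingletonClass X] (H : Measure ℝ≥0)
    [IsProbabilityMeasure H] {F : Finset X} {x : Fin F.card → X} (hx : Function.Injective x)
    (hxF : ∀ i, x i ∈ F) : markVector H x = markLaw H (∑ x ∈ F, Measure.dirac x) := by
  classical
  have himg : Finset.univ.image x = F := by
    refine Finset.eq_of_subset_of_card_le (fun y hy => ?_) ?_
    · obtain ⟨i, _, rfl⟩ := Finset.mem_image.1 hy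
      exact hxF i
    · rw [Finset.card_image_of_injective _ hx, Finset.card_univ, Fintype.card_fin]
  -- An i.i.d. family indexed by `X`, read along the injective `x`, is again i.i.d.
  rw [markVector, ← Measure.infinitePi_eq_pi,
    ← Measure.map_infinitePi_infinitePi_of_inj (P := fun _ : X => H) hx, Measure.map_map
      (measurable_sum_dirac _ fun i => by fun_prop) (by fun_prop), markLaw]
  congr 1
  funext s
  rw [attachMarks_sum_dirac]
  conv_rhs => rw [← himg]
  rw [Finset.sum_image fun a _ b _ h => hx h]
  rfl

/-- A measurable version of the law of the marked configuration. -/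
def markLawVersion (H : Measure ℝ≥0) (m : ℕ) (ν : Measure X) : Measure (Measure (X × ℝ≥0)) :=
  (Measure.pi (fun _ : Fin m => finitePart ν) {e | Function.Injective e})⁻¹ •
    ((Measure.pi fun _ : Fin m => finitePart ν).restrict {e | Function.Injective e}).bind
      (markVector H)

variable [MeasurableEq X]

theorem measurable_markLawVersion (H : Measure ℝ≥0) [IsProbabilityMeasure H] (m : ℕ) :
    Measurable (markLawVersion H m : Measure X → _) := by
  have h1 := measurable_pi_of_isFiniteMeasure (measurable_finitePart (X := X)) m
  refine Measure.measurable_of_measurable_coe _ fun L hL => ?_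
  simp only [markLawVersion, Measure.smul_apply, smul_eq_mul]
  refine ((Measure.measurable_coe (measurableSet_injective m)).comp h1).inv.mul ?_
  refine (Measure.measurable_coe hL).comp ((Measure.measurable_bind'
    (measurable_markVector H m)).comp ?_)
  refine Measure.measurable_of_measurable_coe _ fun s hs => ?_
  simp only [Measure.restrict_apply hs]
  exact (Measure.measurable_coe (hs.inter (measurableSet_injective m))).comp h1

/-- The version averages `markVector` over the orderings of the points of `F`. Each ordering gives
the same law, so the average is that law, with no measurable choice of an ordering needed. -/
theorem markLawVersion_sum_dirac (H : Measure ℝ≥0) [IsProbabilityMeasure H] (F : Finset X) :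
    markLawVersion H F.card (∑ x ∈ F, Measure.dirac x) =
      markLaw H (∑ x ∈ F, Measure.dirac x) := by
  classical
  have := isFiniteMeasure_sum_dirac F
  have hI := measurableSet_injective (X := X) F.card
  ext L hL
  rw [markLawVersion, finitePart_eq_self, pi_sum_dirac, Measure.smul_apply, smul_eq_mul,
    Measure.bind_apply hL (measurable_markVector H _).aemeasurable,
    ← lintegral_indicator hI, lintegral_finsetSum_measure]
  simp only [Measure.coe_finsetSum, Finset.sum_apply]
  have h1 : ∀ e ∈ Fintype.piFinset (fun _ : Fin F.card => F),
      ∫⁻ x, {e : Fin F.card → X | Function.Injective e}.indicator (fun x => markVector H x L) x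
        ∂(Measure.dirac e) =
      Measure.dirac e {e : Fin F.card → X | Function.Injective e} *
        markLaw H (∑ x ∈ F, Measure.dirac x) L := by
    intro e he
    have hm : Measurable fun x : Fin F.card → X => markVector H x L :=
      (Measure.measurable_coe hL).comp (measurable_markVector H _)
    rw [lintegral_dirac' _ (hm.indicator hI), Measure.dirac_apply' _ hI]
    by_cases h : Function.Injective e
    · rw [Set.indicator_of_mem h, Set.indicator_of_mem h,
        markVector_eq_markLaw H h (Fintype.mem_piFinset.1 he), Pi.one_apply, one_mul]
    · rw [Set.indicator_of_notMem h, Set.indicator_of_notMem h, zero_mul]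
  rw [Finset.sum_congr rfl h1, ← Finset.sum_mul, ← mul_assoc, ENNReal.inv_mul_cancel, one_mul]
  -- At least one ordering exists, so the normalising mass is nonzero.
  · have e : Fin F.card ≃ F := F.equivFin.symm
    rw [ne_eq, Finset.sum_eq_zero_iff]
    intro h
    have h2 := h (fun i => (e i : X)) (Fintype.mem_piFinset.2 fun i => (e i).2)
    rw [Measure.dirac_apply' _ hI, Set.indicator_of_mem] at h2
    · exact one_ne_zero h2
    · exact Subtype.val_injective.comp e.injective
  · exact (ENNReal.sum_lt_top.2 fun e _ => measure_lt_top _ _).ne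

theorem aemeasurable_markLaw (H : Measure ℝ≥0) [IsProbabilityMeasure H]
    {Q : Measure (Measure X)} (hQ : ∀ᵐ ν ∂Q, IsFiniteSimple ν) : AEMeasurable (markLaw H) Q := by
  refine ⟨_, measurable_apply_pointCount (measurable_markLawVersion H), ?_⟩
  filter_upwards [hQ] with ν hν
  obtain ⟨F, rfl⟩ := hν
  have h := markLawVersion_sum_dirac H F
  rw [← pointCount_sum_dirac F] at h
  exact h.symm

theorem lintegral_RM (H : Measure ℝ≥0) [IsProbabilityMeasure H] {Q : Measure (Measure X)}
    (hQ : ∀ᵐ ν ∂Q, IsFiniteSimple ν) {f : Measure X → ℝ≥0∞} (hf : Measurable f) :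
    ∫⁻ μ, f μ ∂(RM Q H) =
      ∫⁻ ν, ∫⁻ s, f (weigh (attachMarks ν s)) ∂(Measure.infinitePi fun _ : X => H) ∂Q := by
  have hfw : Measurable fun ψ : Measure (X × ℝ≥0) => f (weigh ψ) := hf.comp measurable_weigh
  rw [RM, lintegral_map hf measurable_weigh, markedLaw,
    Measure.lintegral_bind (aemeasurable_markLaw H hQ) hfw.aemeasurable]
  refine lintegral_congr_ae ?_
  filter_upwards [hQ] with ν hν
  rw [markLaw, lintegral_map hfw (measurable_attachMarks_of_isFiniteSimple hν)]

theorem laplaceMass_RM (H : Measure ℝ≥0) [IsProbabilityMeasure H] {Q : Measure (Measure X)}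
    (hQ : ∀ᵐ ν ∂Q, IsFiniteSimple ν) (u : ℝ) :
    laplaceMass (RM Q H) u = ∫⁻ ν, kappa H u 0 ^ pointCount ν ∂Q := by
  have hm : Measurable fun μ : Measure X => (μ univ).toReal :=
    (Measure.measurable_coe MeasurableSet.univ).ennreal_toReal
  rw [laplaceMass, lintegral_RM H hQ (by fun_prop)]
  refine lintegral_congr_ae ?_
  filter_upwards [hQ] with ν hν
  obtain ⟨F, rfl⟩ := hν
  rw [pointCount_sum_dirac, ← lintegral_exp_sum H F u]
  refine lintegral_congr fun s => ?_
  rw [attachMarks_sum_dirac, weigh_sum_dirac]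
  have : (∑ x ∈ F, (s x : ℝ≥0∞) • Measure.dirac x) univ = ((∑ x ∈ F, s x : ℝ≥0) : ℝ≥0∞) := by
    simp [Measure.coe_finsetSum, Finset.sum_apply]
  rw [this, ENNReal.coe_toReal]

/-- The truncated exponent `m - k` in the weight is harmless: with fewer than `k` points no
injective vector exists and the other factor is 0. -/
theorem sampleLaw_apply (H : Measure ℝ≥0) [IsProbabilityMeasure H] {Q : Measure (Measure X)}
    (hQ : ∀ᵐ ν ∂Q, IsFiniteSimple ν) {n k : ℕ} (hn : 1 ≤ n) {c : Fin n → Fin k}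
    (hc : Function.Surjective c) {C : Set (Fin n → X)} (hC : MeasurableSet C) :
    sampleLaw Q H n (C ∩ {y | Setoid.ker y = Setoid.ker c}) =
      ∫⁻ ν, configurationWeight H c (pointCount ν) * Measure.pi (fun _ : Fin k => ν)
        {e | Function.Injective e ∧ e ∘ c ∈ C} ∂Q := by
  have hA : MeasurableSet (C ∩ {y : Fin n → X | Setoid.ker y = Setoid.ker c}) :=
    hC.inter (measurableSet_ker_eq c)
  have hpi := measurable_pi_of_isFiniteMeasure (measurable_normalize (X := X)) n
  have hpiA : Measurable fun μ : Measure X => Measure.pi (fun _ : Fin n => normalize μ)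
      (C ∩ {y | Setoid.ker y = Setoid.ker c}) := (Measure.measurable_coe hA).comp hpi
  rw [sampleLaw, Measure.bind_apply hA hpi.aemeasurable, lintegral_RM H hQ hpiA]
  refine lintegral_congr_ae ?_
  filter_upwards [hQ] with ν hν
  obtain ⟨F, rfl⟩ := hν
  rw [pointCount_sum_dirac, ← lintegral_pi_normalize H F hn hc hC]
  refine lintegral_congr fun s => ?_
  rw [attachMarks_sum_dirac, weigh_sum_dirac]

end

section

/-! ### Finite simple configurations: measurability and removal of points -/

section FiniteSimple

variable {X : Type*} [MeasurableSpace X]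

/-- A finite measure has only finitely many atoms of mass 1, and here they carry all the mass. -/
theorem isFiniteSimple_of_ae_singleton_eq_one [MeasurableSingletonClass X] (ν : Measure X)
    [IsFiniteMeasure ν] (h : ∀ᵐ x ∂ν, ν {x} = 1) : IsFiniteSimple ν := by
  classical
  set E : Set X := {x | ν {x} = 1} with hE
  have hfin : E.Finite := by
    refine (Measure.finite_const_le_meas_of_disjoint_iUnion ν (ε := 1) one_pos
      (As := fun x : X => {x}) (fun x => measurableSet_singleton x) ?_ ?_).subset fun x hx => ?_
    · intro x y hxy
      exact Set.disjoint_singleton.2 hxy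
    · exact measure_ne_top _ _
    · exact (show ν {x} = 1 from hx).ge
  refine ⟨hfin.toFinset, ?_⟩
  ext B hB
  have h0 : ν B = ν (B ∩ E) := (measure_inter_conull h).symm
  have hBE : (hfin.inter_of_right B).toFinset = hfin.toFinset.filter (· ∈ B) := by
    ext x
    simp [and_comm]
  rw [h0, ← (hfin.inter_of_right B).coe_toFinset, ← sum_measure_singleton, hBE,
    Finset.sum_filter, Measure.coe_finsetSum, Finset.sum_apply]
  refine Finset.sum_congr rfl fun x hx => ?_
  rw [Measure.dirac_apply' _ hB, Set.indicator_apply]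
  exact if_congr Iff.rfl (hfin.mem_toFinset.1 hx) rfl

theorem sum_dirac_singleton [MeasurableSingletonClass X] {F : Finset X} {x : X} (hx : x ∈ F) :
    (∑ y ∈ F, Measure.dirac y) {x} = 1 := by
  classical
  rw [Measure.coe_finsetSum, Finset.sum_apply, Finset.sum_eq_single x]
  · simp
  · intro y _ hy
    simp [hy]
  · exact fun h => (h hx).elim

/-- This replaces the existential over finite sets by conditions that are measurable in `ν`. -/
theorem isFiniteSimple_iff [MeasurableSingletonClass X] (ν : Measure X) :
    IsFiniteSimple ν ↔ ν univ ≠ ∞ ∧ finitePart ν {x | finitePart ν {x} ≠ 1} = 0 := by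
  constructor
  · intro hν
    have := hν.isFiniteMeasure
    refine ⟨measure_ne_top ν univ, ?_⟩
    rw [finitePart_eq_self]
    obtain ⟨F, rfl⟩ := hν
    rw [Measure.coe_finsetSum, Finset.sum_apply, Finset.sum_eq_zero_iff]
    intro x hx
    rw [Measure.dirac_apply, Set.indicator_of_notMem]
    have h1 := sum_dirac_singleton hx
    rw [Measure.coe_finsetSum] at h1
    exact fun h => h h1
  · rintro ⟨h1, h2⟩
    have : IsFiniteMeasure ν := ⟨lt_top_iff_ne_top.2 h1⟩
    rw [finitePart_eq_self] at h2
    exact isFiniteSimple_of_ae_singleton_eq_one ν h2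

theorem measurableSet_isFiniteSimple [MeasurableEq X] :
    MeasurableSet {ν : Measure X | IsFiniteSimple ν} := by
  let K : Kernel (Measure X) X := ⟨finitePart, measurable_finitePart⟩
  have hK : ∀ ν, IsFiniteMeasure (K ν) := fun ν => isFiniteMeasure_finitePart ν
  have h1 : Measurable fun p : Measure X × X => finitePart p.1 {p.2} := by
    -- The singleton `{x}` is a section of the measurable diagonal, so its mass is jointly
    -- measurable in `ν` and `x`.
    have hd : MeasurableSet {q : (Measure X × X) × X | q.2 = q.1.2} :=
      measurableSet_eq_fun measurable_snd (measurable_snd.comp measurable_fst)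
    exact Kernel.measurable_kernel_prodMk_left_of_finite
      (κ := K.comap (Prod.fst : Measure X × X → Measure X) measurable_fst) hd fun p => hK p.1
  have h2 : MeasurableSet {p : Measure X × X | finitePart p.1 {p.2} ≠ 1} :=
    h1 (measurableSet_singleton 1).compl
  have h3 : Measurable fun ν : Measure X => finitePart ν {x | finitePart ν {x} ≠ 1} :=
    Kernel.measurable_kernel_prodMk_left_of_finite (κ := K) h2 hK
  have : {ν : Measure X | IsFiniteSimple ν} = {ν | ν univ = ∞}ᶜ ∩
      {ν | finitePart ν {x | finitePart ν {x} ≠ 1} = 0} := by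
    ext ν
    exact isFiniteSimple_iff ν
  rw [this]
  exact (Measure.measurable_coe MeasurableSet.univ (measurableSet_singleton ∞)).compl.inter
    (h3 (measurableSet_singleton 0))

theorem restrict_sum_dirac [MeasurableSingletonClass X] [DecidableEq X] (F : Finset X) {k : ℕ}
    (x : Fin k → X) : (∑ y ∈ F, Measure.dirac y).restrict (Set.range x)ᶜ =
      ∑ y ∈ F \ Finset.univ.image x, Measure.dirac y := by
  have hR : MeasurableSet (Set.range x)ᶜ := (Set.finite_range x).measurableSet.compl
  ext B hB
  rw [Measure.restrict_apply hB, Finset.sdiff_eq_filter, Finset.sum_filter]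
  simp only [Measure.coe_finsetSum, Finset.sum_apply]
  refine Finset.sum_congr rfl fun y _ => ?_
  rw [Measure.dirac_apply' _ (hB.inter hR)]
  by_cases hy : y ∈ Set.range x
  · have : ¬ y ∉ Finset.univ.image x := by simpa using hy
    rw [if_neg this, Set.indicator_of_notMem fun h => h.2 hy]
    rfl
  · have : y ∉ Finset.univ.image x := by simpa using hy
    rw [if_pos this, Measure.dirac_apply' _ hB]
    by_cases hyB : y ∈ B
    · rw [Set.indicator_of_mem hyB,
        Set.indicator_of_mem (show y ∈ B ∩ (Set.range x)ᶜ from ⟨hyB, hy⟩)]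
    · rw [Set.indicator_of_notMem hyB, Set.indicator_of_notMem fun h => hyB h.1]

/-- Removing points from a configuration is restriction to the complement of these points. -/
theorem sub_sum_dirac_eq_restrict [MeasurableSingletonClass X] {F : Finset X} {k : ℕ}
    {x : Fin k → X} (hx : Function.Injective x) (hxF : ∀ j, x j ∈ F) :
    (∑ y ∈ F, Measure.dirac y) - ∑ j, Measure.dirac (x j) =
      (∑ y ∈ F, Measure.dirac y).restrict (Set.range x)ᶜ := by
  classical
  have hsub : Finset.univ.image x ⊆ F := by
    intro y hy
    obtain ⟨j, _, rfl⟩ := Finset.mem_image.1 hy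
    exact hxF j
  have h1 : ∑ j, Measure.dirac (x j) = ∑ y ∈ Finset.univ.image x, Measure.dirac y :=
    (Finset.sum_image fun a _ b _ h => hx h).symm
  have := isFiniteMeasure_sum_dirac (Finset.univ.image x)
  rw [restrict_sum_dirac, h1, ← Finset.sum_sdiff hsub, Measure.add_sub_cancel]

end FiniteSimple

/-! ### Campbell's formula and the reduced Palm distributions -/

section Palm

variable {X : Type*} [MeasurableSpace X] {Q : Measure (Measure X)} {k : ℕ}
  {P : Kernel (Fin k → X) (Measure X)}

/-- The Campbell formula for functions of the configuration. -/
theorem IsPalmKernel.lintegral_mul_pi (hP : IsPalmKernel Q P)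
    (hQ : ∀ᵐ ν ∂Q, IsFiniteSimple ν) {f : Measure X → ℝ≥0∞} (hf : Measurable f)
    {A : Set (Fin k → X)} (hA : MeasurableSet A) :
    ∫⁻ ν, f ν * Measure.pi (fun _ : Fin k => ν) A ∂Q =
      ∫⁻ x in A, ∫⁻ ν, f ν ∂(P x) ∂(momentMeasure Q k) := by
  have hpi : AEMeasurable (fun ν : Measure X => Measure.pi (fun _ : Fin k => ν) A) Q :=
    (Measure.measurable_coe hA).comp_aemeasurable (aemeasurable_pi hQ k)
  -- For fixed `A` the disintegration is an equality of two measures in `L`; `f` is then integrated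
  -- against both.
  have h1 : Q.withDensity (fun ν => Measure.pi (fun _ : Fin k => ν) A) =
      ((momentMeasure Q k).restrict A).bind P := by
    ext L hL
    rw [withDensity_apply _ hL, Measure.bind_apply hL P.aemeasurable,
      hP.disintegrates A L hA hL]
  rw [← Measure.lintegral_bind P.aemeasurable hf.aemeasurable, ← h1,
    lintegral_withDensity_eq_lintegral_mul₀ hpi hf.aemeasurable]
  refine lintegral_congr fun ν => ?_
  rw [Pi.mul_apply, mul_comm]

/-- The Campbell measure does not charge the `Q`-null set of non-simple configurations. -/
theorem IsPalmKernel.ae_isFiniteSimple [MeasurableEq X] (hP : IsPalmKernel Q P)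
    (hQ : ∀ᵐ ν ∂Q, IsFiniteSimple ν) :
    ∀ᵐ x ∂(momentMeasure Q k), ∀ᵐ ν ∂(P x), IsFiniteSimple ν := by
  have hS := (measurableSet_isFiniteSimple (X := X)).compl
  have h := hP.disintegrates univ _ MeasurableSet.univ hS
  rw [setLIntegral_measure_zero _ _ hQ, Measure.restrict_univ] at h
  have h2 := (lintegral_eq_zero_iff (Kernel.measurable_coe P hS)).1 h.symm
  filter_upwards [h2] with x hx
  exact hx

/-- If `ν B = 0`, the product measure of `{x | x j ∈ B}` is 0, so the Campbell measure does not
charge this combination. Letting `B` run through a countable base will locate `x j` in the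
configuration. -/
theorem IsPalmKernel.ae_apply_ne_zero (hP : IsPalmKernel Q P)
    (hQ : ∀ᵐ ν ∂Q, IsFiniteSimple ν) {B : Set X} (hB : MeasurableSet B) (j : Fin k) :
    ∀ᵐ x ∂(momentMeasure Q k), x j ∈ B → ∀ᵐ ν ∂(P x), ν B ≠ 0 := by
  have hL : MeasurableSet {ν : Measure X | ν B = 0} :=
    Measure.measurable_coe hB (measurableSet_singleton 0)
  have hA : MeasurableSet {x : Fin k → X | x j ∈ B} := measurable_pi_apply j hB
  have h := hP.disintegrates _ _ hA hL
  have h0 : ∫⁻ ν in {ν : Measure X | ν B = 0},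
      (Measure.pi fun _ : Fin k => ν) {x : Fin k → X | x j ∈ B} ∂Q = 0 := by
    refine (setLIntegral_congr_fun_ae hL ?_).trans lintegral_zero
    filter_upwards [hQ] with ν hν hνB
    have := hν.isFiniteMeasure
    exact Measure.pi_eval_preimage_null (μ := fun _ : Fin k => ν) hνB
  rw [h0] at h
  have h2 := (setLIntegral_eq_zero_iff hA (Kernel.measurable_coe P hL)).1 h.symm
  filter_upwards [h2] with x hx hxB
  rw [ae_iff]
  simpa using hx hxB

/-- Under the Palm distribution at `x` the points of `x` belong to the configuration. -/
theorem IsPalmKernel.ae_exists_finset [TopologicalSpace X] [T1Space X]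
    [SecondCountableTopology X] [OpensMeasurableSpace X] [MeasurableEq X]
    (hP : IsPalmKernel Q P) (hQ : ∀ᵐ ν ∂Q, IsFiniteSimple ν) :
    ∀ᵐ x ∂(momentMeasure Q k), ∀ᵐ ν ∂(P x), ∃ F : Finset X,
      ν = ∑ y ∈ F, Measure.dirac y ∧ ∀ j, x j ∈ F := by
  have hb := TopologicalSpace.isBasis_countableBasis X
  have h1 : ∀ᵐ x ∂(momentMeasure Q k), ∀ j : Fin k,
      ∀ B : TopologicalSpace.countableBasis X, x j ∈ (B : Set X) →
        ∀ᵐ ν ∂(P x), ν (B : Set X) ≠ 0 := by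
    have : Countable (TopologicalSpace.countableBasis X) :=
      (TopologicalSpace.countable_countableBasis X).to_subtype
    exact ae_all_iff.2 fun j => ae_all_iff.2 fun B =>
      hP.ae_apply_ne_zero hQ (hb.isOpen B.2).measurableSet j
  filter_upwards [h1, hP.ae_isFiniteSimple hQ] with x hx hxS
  have h2 : ∀ᵐ ν ∂(P x), ∀ j : Fin k, ∀ B : TopologicalSpace.countableBasis X,
      x j ∈ (B : Set X) → ν (B : Set X) ≠ 0 := by
    have : Countable (TopologicalSpace.countableBasis X) :=
      (TopologicalSpace.countable_countableBasis X).to_subtype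
    refine ae_all_iff.2 fun j => ae_all_iff.2 fun B => ?_
    by_cases h : x j ∈ (B : Set X)
    · filter_upwards [hx j B h] with ν hν _
      exact hν
    · exact Filter.Eventually.of_forall fun ν h' => (h h').elim
  filter_upwards [h2, hxS] with ν hν hνS
  obtain ⟨F, rfl⟩ := hνS
  refine ⟨F, rfl, fun j => ?_⟩
  -- A missing `x j` has a basic neighbourhood disjoint from the closed set `F`, hence of `ν`-mass
  -- 0.
  by_contra hj
  obtain ⟨B, hB, hjB, hBF⟩ := hb.exists_subset_of_mem_open
    (show x j ∈ ((F : Set X))ᶜ from hj) F.finite_toSet.isClosed.isOpen_compl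
  refine hν j ⟨B, hB⟩ hjB ?_
  simp only [Measure.coe_finsetSum, Finset.sum_apply, Finset.sum_eq_zero_iff]
  intro y hy
  rw [Measure.dirac_apply' _ (hb.isOpen hB).measurableSet, Set.indicator_of_notMem]
  exact fun h => hBF h hy

/-- The Laplace transform of the total mass of the marked reduced Palm configuration. -/
theorem laplaceMass_RM_reducedPalm [MeasurableEq X] (H : Measure ℝ≥0) [IsProbabilityMeasure H]
    {x : Fin k → X} (hx : Function.Injective x)
    (hPx : ∀ᵐ ν ∂(P x), ∃ F : Finset X, ν = ∑ y ∈ F, Measure.dirac y ∧ ∀ j, x j ∈ F) (u : ℝ) :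
    laplaceMass (RM (reducedPalm P x) H) u = ∫⁻ ν, kappa H u 0 ^ (pointCount ν - k) ∂(P x) := by
  classical
  have hR : MeasurableSet (Set.range x)ᶜ := (Set.finite_range x).measurableSet.compl
  have hm : Measurable fun ν : Measure X => ν.restrict (Set.range x)ᶜ := by
    refine Measure.measurable_of_measurable_coe _ fun B hB => ?_
    simp only [Measure.restrict_apply hB]
    exact Measure.measurable_coe (hB.inter hR)
  -- Subtraction of the points agrees almost surely with a restriction, whose measurability in `ν`
  -- is clear.
  have hred : reducedPalm P x = (P x).map fun ν => ν.restrict (Set.range x)ᶜ := by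
    refine Measure.map_congr ?_
    filter_upwards [hPx] with ν hν
    obtain ⟨F, rfl, hF⟩ := hν
    exact sub_sum_dirac_eq_restrict hx hF
  have hsimple : ∀ᵐ ν ∂(reducedPalm P x), IsFiniteSimple ν := by
    rw [hred, ae_map_iff hm.aemeasurable measurableSet_isFiniteSimple]
    filter_upwards [hPx] with ν hν
    obtain ⟨F, rfl, -⟩ := hν
    exact ⟨_, restrict_sum_dirac F x⟩
  have hpow : Measurable fun ν : Measure X => kappa H u 0 ^ pointCount ν :=
    (measurable_from_nat (f := fun m => kappa H u 0 ^ m)).comp measurable_pointCount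
  rw [laplaceMass_RM H hsimple, hred, lintegral_map hpow hm]
  refine lintegral_congr_ae ?_
  filter_upwards [hPx] with ν hν
  obtain ⟨F, rfl, hF⟩ := hν
  have hsub : Finset.univ.image x ⊆ F := by
    intro y hy
    obtain ⟨j, _, rfl⟩ := Finset.mem_image.1 hy
    exact hF j
  rw [restrict_sum_dirac, pointCount_sum_dirac, pointCount_sum_dirac,
    Finset.card_sdiff_of_subset hsub, Finset.card_image_of_injective _ hx, Finset.card_univ,
    Fintype.card_fin]

/-- By Tonelli, the expectation under `P x` moves inside the `u`-integral, where it meets only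
`κ(u,0)^{m-k}`, whose mean is the reduced Palm Laplace transform. -/
theorem marginalDensity_eq [MeasurableEq X] (H : Measure ℝ≥0) [IsProbabilityMeasure H]
    [IsMarkovKernel P] {n : ℕ} (c : Fin n → Fin k)
    {x : Fin k → X} (hx : Function.Injective x)
    (hPx : ∀ᵐ ν ∂(P x), ∃ F : Finset X, ν = ∑ y ∈ F, Measure.dirac y ∧ ∀ j, x j ∈ F) :
    marginalDensity H P c x = ∫⁻ ν, configurationWeight H c (pointCount ν) ∂(P x) := by
  have hk := fun m => measurable_kappa H m
  have hpow : Measurable fun p : ℝ × ℕ => kappa H p.1 0 ^ (p.2 - k) :=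
    measurable_from_prod_countable_left fun m => (hk 0).pow_const (m - k)
  have hpc := measurable_pointCount (X := X)
  have hpow2 : Measurable fun p : Measure X × ℝ => kappa H p.2 0 ^ (pointCount p.1 - k) :=
    hpow.comp (measurable_snd.prodMk (hpc.comp measurable_fst))
  unfold configurationWeight
  rw [lintegral_lintegral_swap]
  · unfold marginalDensity
    refine lintegral_congr fun u => ?_
    have hpowu : Measurable fun ν : Measure X => kappa H u 0 ^ (pointCount ν - k) :=
      hpow2.comp measurable_prodMk_right
    rw [lintegral_mul_const _ (hpowu.const_mul _), lintegral_const_mul _ hpowu,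
      laplaceMass_RM_reducedPalm H hx hPx]
  · refine Measurable.aemeasurable ?_
    unfold Function.uncurry
    fun_prop

end Palm

end

end NormalizedRM

end

/-! ### The marginal law of the sample -/

theorem mainTheorem2 {X : Type*} [TopologicalSpace X] [PolishSpace X] [MeasurableSpace X]
    [BorelSpace X]
    (PΦ : Measure (Measure X)) [IsProbabilityMeasure PΦ]
    (hΦ : ∀ᵐ ν ∂PΦ, NormalizedRM.IsFiniteSimple ν)
    (H : Measure ℝ≥0) [IsProbabilityMeasure H]
    (n k : ℕ) (hn : 1 ≤ n) (c : Fin n → Fin k) (hc : Function.Surjective c)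
    (P : Kernel (Fin k → X) (Measure X)) (hP : NormalizedRM.IsPalmKernel PΦ P) :
    -- the joint law of the distinct values and of the partition
    (∀ B : Set (Fin k → X), MeasurableSet B →
      NormalizedRM.sampleLaw PΦ H n
          {y | Setoid.ker y = Setoid.ker c ∧ NormalizedRM.blockValues hc y ∈ B} =
        ∫⁻ ystar in B ∩ {ystar | Function.Injective ystar},
          NormalizedRM.marginalDensity H P c ystar ∂(NormalizedRM.momentMeasure PΦ k)) ∧
    -- the law of the sample itself, on the samples that induce this partition
    (∀ C : Set (Fin n → X), MeasurableSet C →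
      NormalizedRM.sampleLaw PΦ H n (C ∩ {y | Setoid.ker y = Setoid.ker c}) =
        ∫⁻ ystar in {ystar | Function.Injective ystar ∧ ystar ∘ c ∈ C},
          NormalizedRM.marginalDensity H P c ystar ∂(NormalizedRM.momentMeasure PΦ k)) := by
  have := hP.isMarkov
  have sample : ∀ C : Set (Fin n → X), MeasurableSet C →
      NormalizedRM.sampleLaw PΦ H n (C ∩ {y | Setoid.ker y = Setoid.ker c}) =
        ∫⁻ ystar in {ystar | Function.Injective ystar ∧ ystar ∘ c ∈ C},
          NormalizedRM.marginalDensity H P c ystar ∂(NormalizedRM.momentMeasure PΦ k) := by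
    intro C hC
    have hD : MeasurableSet {e : Fin k → X | Function.Injective e ∧ e ∘ c ∈ C} :=
      (NormalizedRM.measurableSet_injective k).inter
        ((measurable_pi_lambda _ fun i => measurable_pi_apply (c i)) hC)
    have hw : Measurable fun ν : Measure X =>
        NormalizedRM.configurationWeight H c (NormalizedRM.pointCount ν) :=
      (measurable_from_nat (f := NormalizedRM.configurationWeight H c)).comp
        NormalizedRM.measurable_pointCount
    rw [NormalizedRM.sampleLaw_apply H hΦ hn hc hC, hP.lintegral_mul_pi hΦ hw hD]
    -- The kernel is an arbitrary version, so the density is identified only for almost every `x`;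
    -- injectivity comes from the domain of integration.
    refine setLIntegral_congr_fun_ae hD ?_
    filter_upwards [hP.ae_exists_finset hΦ] with x hx hxD
    exact (NormalizedRM.marginalDensity_eq H c hxD.1 hx).symm
  refine ⟨fun B hB => ?_, sample⟩
  have hC : MeasurableSet {y : Fin n → X | NormalizedRM.blockValues hc y ∈ B} :=
    (measurable_pi_lambda _ fun j => measurable_pi_apply (Function.surjInv hc j)) hB
  have h1 : {y : Fin n → X | Setoid.ker y = Setoid.ker c ∧ NormalizedRM.blockValues hc y ∈ B} =
      {y | NormalizedRM.blockValues hc y ∈ B} ∩ {y | Setoid.ker y = Setoid.ker c} := by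
    ext y
    exact and_comm
  -- The block values of `e ∘ c` are `e`, so the first claim is the second for the preimage of `B`
  -- under `blockValues hc`.
  have h2 : B ∩ {e : Fin k → X | Function.Injective e} =
      {e | Function.Injective e ∧ e ∘ c ∈ {y | NormalizedRM.blockValues hc y ∈ B}} := by
    ext e
    simp only [Set.mem_inter_iff, Set.mem_ofPred_eq, NormalizedRM.blockValues_comp, and_comm]
  rw [h1, h2]
  exact sample _ hC
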